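/- Let $G=(V,E)$ be a finite graph with nonempty vertex set (loops and multiple edges allowed, $G$ not necessarily connected) and let $\mathbf k$ be a field. Let $\mathbb E$ be the set of arrows of $G$: each edge gives two mutually reverse arrows $a,\bar a$ (also if it is a loop); an arrow $a=v\to w$ has tail $v$ and head $w$. For $v\in V$ let $\mathbb E_v$ be the set of arrows with tail $v$. Let $\pi=(\pi_1,\dots,\pi_r)$ be an ordered partition of $V$ into nonempty parts, with level function $h\colon V\to\{1,\dots,r\}$, $h(v)=n$ for $v\in\pi_n$. An arrow $u\to v$ is upward if $h(u)>h(v)$, downward if $h(u)<h(v)$, and horizontal if $h(u)=h(v)$. The residue space $\mathcal G_\pi\subseteq \mathbf k^{\mathbb E}$ is the space of all $\psi$ such that (R1) $\psi_a=0$ for every downward arrow $a$; (R2) $\sum_{a\in\mathbb E_v}\psi_a=0$ for every $v\in V$; (R3) $\psi_a+\psi_{\bar a}=0$ for every horizontal arrow $a$; (R4) for every level $n$ and every connected component $\Xi$ of the subgraph of $G$ induced on $\{v\in V: h(v)<n\}$, the sum of $\psi_a$ over all upward arrows $a$ with tail of level $n$ and head in $\Xi$ is $0$. For $I\subseteq V$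 let $\mathrm{proj}_I\colon \mathbf k^{\mathbb E}=\bigoplus_{v\in V}\mathbf k^{\mathbb E_v}\to\bigoplus_{v\in I}\mathbf k^{\mathbb E_v}$ be the projection and put $\gamma_\pi(I)=\dim_{\mathbf k}\mathrm{proj}_I(\mathcal G_\pi)$. Let $$P_\pi=\Bigl\{q\in\mathbb R^V : \sum_{v\in I}q(v)\le\gamma_\pi(I)\ \text{for all } I\subseteq V,\ \text{with equality for } I=V\Bigr\}$$ be the base polytope of the submodular function $\gamma_\pi$. Let $\pi_0=(V)$ be the ordered partition with one part, and call $P_{\mathrm{res}}(G)=P_{\pi_0}$ the residue polytope of $G$. An ordered partition $\pi'=(\pi'_1,\dots,\pi'_s)$ with level function $h'$ is a coarsening of $\pi$ if $h'=c\circ h$ for a nondecreasing map $c\colon\{1,\dots,r\}\to\{1,\dots,s\}$. A face of a polytope $P$ is here a nonempty subset of $P$ on which some (possibly zero) linear functional attains its maximum over $P$. Then: (1) for every ordered partition $\pi$ of $V$, $P_\pi$ is a face of $P_{\mathrm{res}}(G)$; (2) every face of $P_{\mathrm{res}}(G)$ equals $P_\pi$ for some ordered partition $\pi$ of $V$; (3)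 if $\pi'$ is a coarsening of $\pi$, then $P_\pi\subseteq P_{\pi'}$, and $P_\pi$ is a face of $P_{\pi'}$. -/

import Mathlib

/-- A graph on the vertex set `V`, with loops and multiple edges allowed, given by its set `A` of
arrows. Each arrow has a tail, and `bar` is the reversal of arrows. The edges are the two-element
sets `{a, bar a}`; in particular a loop carries two distinct arrows. -/
structure ArrowGraph (V A : Type*) where
  tail : A → V
  bar : A → A
  bar_bar : ∀ a, bar (bar a) = a
  bar_ne : ∀ a, bar a ≠ a

/-- An ordered partition of `V` into `r` nonempty parts, given by its level function, a surjection
of `V` onto `r` linearly ordered levels (here numbered from `0`). The parts are the fibres. -/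
structure OrderedPartition (V : Type*) where
  r : ℕ
  level : V → Fin r
  surj : Function.Surjective level

namespace OrderedPartition

variable {V : Type*}

/-- The ordered partition with the single part `V`. -/
def trivial (V : Type*) [Nonempty V] : OrderedPartition V where
  r := 1
  level := fun _ => 0
  surj := fun _ => ⟨Classical.arbitrary V, Subsingleton.elim _ _⟩

/-- `π'.IsCoarsening π`: the level function of `π'` factors through that of `π` by a
nondecreasing map of levels. -/
def IsCoarsening (π' π : OrderedPartition V) : Prop :=
  ∃ c : Fin π.r → Fin π'.r, Monotone c ∧ π'.level = c ∘ π.level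

end OrderedPartition

namespace ArrowGraph

variable {V A : Type*}

def head (G : ArrowGraph V A) (a : A) : V := G.tail (G.bar a)

/-- The underlying simple graph; it has the same connected components, also after passing to the
subgraph induced on a set of vertices. -/
def toSimpleGraph (G : ArrowGraph V A) : SimpleGraph V :=
  SimpleGraph.fromRel fun u v => ∃ a, G.tail a = u ∧ G.head a = v

def IsUpward (G : ArrowGraph V A) (π : OrderedPartition V) (a : A) : Prop :=
  π.level (G.head a) < π.level (G.tail a)

def IsDownward (G : ArrowGraph V A) (π : OrderedPartition V) (a : A) : Prop :=
  π.level (G.tail a) < π.level (G.head a)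

def IsHorizontal (G : ArrowGraph V A) (π : OrderedPartition V) (a : A) : Prop :=
  π.level (G.tail a) = π.level (G.head a)

/-- The subgraph induced on the vertices of level smaller than `n`. -/
def below (G : ArrowGraph V A) (π : OrderedPartition V) (n : Fin π.r) :
    SimpleGraph {v : V | π.level v < n} :=
  G.toSimpleGraph.induce {v : V | π.level v < n}

/-- The upward arrows with tail of level `n` and head in the connected component `Ξ` of the
subgraph induced on the vertices of level smaller than `n`. -/
def arrowsInto (G : ArrowGraph V A) (π : OrderedPartition V) (n : Fin π.r)
    (Ξ : (G.below π n).ConnectedComponent) : Set A :=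
  {a | G.IsUpward π a ∧ π.level (G.tail a) = n ∧ G.head a ∈ Subtype.val '' Ξ.supp}

open scoped Classical in
/-- The residue space of the level graph `(G, π)`. -/
noncomputable def residueSpace (k : Type*) [Field k] [Fintype A] (G : ArrowGraph V A)
    (π : OrderedPartition V) : Submodule k (A → k) where
  carrier := {ψ |
    (∀ a, G.IsDownward π a → ψ a = 0) ∧
    (∀ v : V, ∑ a with G.tail a = v, ψ a = 0) ∧
    (∀ a, G.IsHorizontal π a → ψ a + ψ (G.bar a) = 0) ∧
    (∀ (n : Fin π.r) (Ξ : (G.below π n).ConnectedComponent),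
      ∑ a with a ∈ G.arrowsInto π n Ξ, ψ a = 0)}
  zero_mem' := by simp
  add_mem' := by
    rintro x y ⟨h1, h2, h3, h4⟩ ⟨g1, g2, g3, g4⟩
    refine ⟨fun a ha => ?_, fun v => ?_, fun a ha => ?_, fun n Ξ => ?_⟩
    · simp [h1 a ha, g1 a ha]
    · simp only [Pi.add_apply, Finset.sum_add_distrib, h2 v, g2 v, add_zero]
    · have e : (x + y) a + (x + y) (G.bar a)
          = (x a + x (G.bar a)) + (y a + y (G.bar a)) := by
        simp only [Pi.add_apply]; ring
      rw [e, h3 a ha, g3 a ha, add_zero]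
    · simp only [Pi.add_apply, Finset.sum_add_distrib, h4 n Ξ, g4 n Ξ, add_zero]
  smul_mem' := by
    rintro c x ⟨h1, h2, h3, h4⟩
    refine ⟨fun a ha => ?_, fun v => ?_, fun a ha => ?_, fun n Ξ => ?_⟩
    · simp [h1 a ha]
    · simp only [Pi.smul_apply, smul_eq_mul, ← Finset.mul_sum, h2 v, mul_zero]
    · simp only [Pi.smul_apply, smul_eq_mul, ← mul_add, h3 a ha, mul_zero]
    · simp only [Pi.smul_apply, smul_eq_mul, ← Finset.mul_sum, h4 n Ξ, mul_zero]

/-- The projection onto the coordinates indexed by the arrows with tail in `I`. -/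
def proj (k : Type*) [Field k] (G : ArrowGraph V A) (I : Finset V) :
    (A → k) →ₗ[k] ({a : A // G.tail a ∈ I} → k) :=
  LinearMap.funLeft k k Subtype.val

/-- The submodular function of the residue space: `I ↦ dim proj_I (residueSpace)`. -/
noncomputable def gam (k : Type*) [Field k] [Fintype A] (G : ArrowGraph V A)
    (π : OrderedPartition V) (I : Finset V) : ℕ :=
  Module.finrank k ((G.residueSpace k π).map (G.proj k I))

end ArrowGraph

/-- The base polytope of a set function `f`. -/
def basePolytope {V : Type*} [Fintype V] (f : Finset V → ℝ) : Set (V → ℝ) :=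
  {q | (∀ I : Finset V, ∑ v ∈ I, q v ≤ f I) ∧ ∑ v, q v = f Finset.univ}

/-- The residue polytope of the level graph `(G, π)`. -/
def ArrowGraph.residuePolytope {V A : Type*} (k : Type*) [Field k] [Fintype V] [Fintype A]
    (G : ArrowGraph V A) (π : OrderedPartition V) : Set (V → ℝ) :=
  basePolytope fun I => (G.gam k π I : ℝ)

/-- `F` is a (nonempty) face of the polytope `P`: the set of points of `P` at which some linear
functional attains its maximum over `P`. The functional may be zero, so `P` is a face of itself. -/
def IsFace {V : Type*} (P F : Set (V → ℝ)) : Prop :=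
  F.Nonempty ∧ IsExposed ℝ P F

/-! Write `f` for the rank function of the one-level partition, whose residue space is the space of
flows on the graph: antisymmetric functions with zero divergence. By Abel summation and the greedy
algorithm, the maximizers over a base polytope of a functional with coefficients `ω (h v)`, `ω`
increasing, are the points tight at all upper level sets of `h` (`tightFace_eq_maximizers`). So
everything reduces to `residuePolytope_eq_tightFace`: the polytope of `π` is the tight face of its
level function.

By `basePolytope_eq_tightFace` this needs two facts about the rank function of `π`. It is additive
over levels, because each residue condition involves tails of one level only
(`gam_eq_add_of_level`). On level `n` it is the contraction of `f` by the levels above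
(`gam_level`), because the level `n` parts of the residue space are exactly those of flows vanishing
above `n`: condition (R4) is what allows such a part to be completed by a flow below `n`.

Coarsening `π` removes tightness conditions, which gives the inclusions in (3). -/

/-! ### Faces of base polytopes of submodular functions. -/

section Polymatroid

variable {V : Type*} [Fintype V]

/-- The points of the base polytope of `f` at which the inequalities of all upper level sets of `h`
are tight. -/
def tightFace (f : Finset V → ℝ) (h : V → ℕ) : Set (V → ℝ) :=
  {q | q ∈ basePolytope f ∧ ∀ n, ∑ v with n ≤ h v, q v = f {v | n ≤ h v}}

/-- The hypothesis says that `b - a` on the truncations of `I` does not decrease as the threshold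
drops. Start from a threshold above all of `I` and descend to `0`. -/
lemma le_of_forall_level {V : Type*} {h : V → ℕ} {a b : Finset V → ℝ} (h0 : a ∅ ≤ b ∅)
    (hab : ∀ (I : Finset V) (n : ℕ), a {v ∈ I | n ≤ h v} + b {v ∈ I | n + 1 ≤ h v} ≤
      b {v ∈ I | n ≤ h v} + a {v ∈ I | n + 1 ≤ h v})
    (I : Finset V) : a I ≤ b I := by
  obtain ⟨N, hN⟩ : ∃ N, ∀ v ∈ I, h v < N :=
    ⟨I.sup h + 1, fun v hv => Nat.lt_succ_of_le (Finset.le_sup hv)⟩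
  have key : ∀ m n, m + n = N → a {v ∈ I | n ≤ h v} ≤ b {v ∈ I | n ≤ h v} := by
    intro m
    induction m with
    | zero =>
      intro n hn
      have : ({v ∈ I | n ≤ h v} : Finset V) = ∅ := by
        apply Finset.filter_false_of_mem
        intro v hv
        have := hN v hv
        omega
      rw [this]; exact h0
    | succ m ih =>
      intro n hn
      have := ih (n + 1) (by omega)
      linarith [hab I n]
  simpa using key N 0 (by simp)

/-- The base polytope of a function that is additive over the levels of `h` and agrees on each level
with the contraction of `f` is a tight face of the base polytope of `f`. -/
theorem basePolytope_eq_tightFace [DecidableEq V] {f g : Finset V → ℝ} {h : V → ℕ}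
    (f0 : f ∅ = 0)
    (hf : ∀ I J, f (I ∪ J) + f (I ∩ J) ≤ f I + f J)
    (hadd : ∀ (p : ℕ → Prop) [DecidablePred p] (I : Finset V),
      g I = g {v ∈ I | p (h v)} + g {v ∈ I | ¬ p (h v)})
    (hlev : ∀ (n : ℕ) (I : Finset V), (∀ v ∈ I, h v = n) →
      g I + f {v | n + 1 ≤ h v} = f ((Finset.univ.filter fun v => n + 1 ≤ h v) ∪ I)) :
    basePolytope g = tightFace f h := by
  have g0 : g ∅ = 0 := by
    have := hadd (fun _ => True) ∅
    simp at this
    exact this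
  have glev : ∀ (I : Finset V) (n : ℕ), g {v ∈ I | n ≤ h v} =
      g {v ∈ I | h v = n} + g {v ∈ I | n + 1 ≤ h v} := by
    intro I n
    rw [hadd (fun m => m = n)]
    simp only [Finset.filter_filter]
    congr 2 <;> ext v <;> simp <;> omega
  have gtop : ∀ n, g {v | n ≤ h v} = f {v | n ≤ h v} := by
    obtain ⟨N, hN⟩ : ∃ N, ∀ v, h v < N :=
      ⟨Finset.univ.sup h + 1, fun v => Nat.lt_succ_of_le (Finset.le_sup (Finset.mem_univ v))⟩
    have key : ∀ m n, N ≤ m + n → g {v | n ≤ h v} = f {v | n ≤ h v} := by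
      intro m
      induction m with
      | zero =>
        intro n hn
        have : ({v | n ≤ h v} : Finset V) = ∅ := by
          apply Finset.filter_false_of_mem
          intro v _
          have := hN v
          omega
        rw [this, f0, g0]
      | succ m ih =>
        intro n hn
        have h1 := ih (n + 1) (by omega)
        have h2 := hlev n {v | h v = n} (by simp)
        have h3 : (Finset.univ.filter fun v => n + 1 ≤ h v) ∪ (Finset.univ.filter fun v => h v = n) =
            Finset.univ.filter fun v => n ≤ h v := by
          ext v; simp; omega
        rw [h3] at h2
        rw [glev, ← h2, h1]
    exact fun n => key N n (by simp)
  -- Diminishing returns: adding level `n` of `I` to all levels above raises `f` by no more than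
  -- adding it to the part of `I` above.
  have gle : ∀ I, g I ≤ f I := by
    apply le_of_forall_level (h := h)
    · rw [f0, g0]
    · intro I n
      have h1 := hlev n {v ∈ I | h v = n} (by simp)
      have h2 := hf (Finset.univ.filter fun v => n + 1 ≤ h v) {v ∈ I | n ≤ h v}
      have h3 : (Finset.univ.filter fun v => n + 1 ≤ h v) ∩ {v ∈ I | n ≤ h v} =
          {v ∈ I | n + 1 ≤ h v} := by
        ext v; simp; grind
      have h4 : (Finset.univ.filter fun v => n + 1 ≤ h v) ∪ {v ∈ I | n ≤ h v} =
          (Finset.univ.filter fun v => n + 1 ≤ h v) ∪ {v ∈ I | h v = n} := by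
        ext v; simp; grind
      rw [h3, h4] at h2
      linarith [glev I n]
  have guniv : g Finset.univ = f Finset.univ := by simpa using gtop 0
  ext q
  constructor
  · rintro ⟨hq, hqu⟩
    refine ⟨⟨fun I => (hq I).trans (gle I), hqu.trans guniv⟩, fun n => le_antisymm ?_ ?_⟩
    · exact (hq _).trans (gtop n).le
    -- The total is fixed and `g` is additive, so the upper bound on the complement is a lower bound
    -- here.
    · have h1 := hq {v | ¬ n ≤ h v}
      have h2 := hadd (fun m => n ≤ m) Finset.univ
      have h3 := Finset.sum_filter_add_sum_filter_not Finset.univ (fun v => n ≤ h v) q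
      rw [← gtop]
      linarith
  · rintro ⟨⟨hq, hqu⟩, ht⟩
    refine ⟨?_, hqu.trans guniv.symm⟩
    apply le_of_forall_level (h := h)
    · simp [g0]
    · intro I n
      have h1 := hlev n {v ∈ I | h v = n} (by simp)
      -- Subtracting the tight equality above level `n` bounds `q` on level `n` of `I` by the
      -- contraction, hence by `g`.
      have h2 := hq ((Finset.univ.filter fun v => n + 1 ≤ h v) ∪ {v ∈ I | h v = n})
      have h3 : ∑ v ∈ I with n ≤ h v, q v =
          ∑ v ∈ I with h v = n, q v + ∑ v ∈ I with n + 1 ≤ h v, q v := by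
        rw [← Finset.sum_filter_add_sum_filter_not {v ∈ I | n ≤ h v} (fun v => h v = n) q]
        simp only [Finset.filter_filter]
        congr 2 <;> ext v <;> simp <;> omega
      rw [Finset.sum_union, ht] at h2
      · linarith [glev I n]
      · rw [Finset.disjoint_left]
        intro v; simp; omega

/-- The greedy algorithm: a base polytope has a point that is tight at a given chain. -/
theorem tightFace_nonempty [DecidableEq V] {f : Finset V → ℝ} (f0 : f ∅ = 0)
    (hf : ∀ I J, f (I ∪ J) + f (I ∩ J) ≤ f I + f J) (h : V → ℕ) :
    (tightFace f h).Nonempty := by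
  obtain ⟨R, hR⟩ : ∃ R, ∀ v, h v ≤ R :=
    ⟨Finset.univ.sup h, fun v => Finset.le_sup (Finset.mem_univ v)⟩
  obtain ⟨g, hg, hgh⟩ : ∃ g : V → ℕ, Function.Injective g ∧
      ∀ n, ∃ m, ∀ v, n ≤ h v ↔ g v < m := by
    have e := Fintype.equivFin V
    -- Lexicographic order: decreasing `h`, ties broken by `e`. Upper level sets of `h` become
    -- initial segments.
    refine ⟨fun v => (R - h v) * Fintype.card V + e v, ?_, ?_⟩
    · intro v w hvw
      have h1 := congrArg (· % Fintype.card V) hvw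
      simp only [Nat.mul_add_mod_self_right, Nat.mod_eq_of_lt (e _).2] at h1
      exact e.injective (Fin.ext h1)
    · intro n
      rcases le_or_gt n R with hn | hn
      · refine ⟨(R - n + 1) * Fintype.card V, fun v => ⟨fun hv => ?_, fun hv => ?_⟩⟩
        · have : R - h v + 1 ≤ R - n + 1 := by omega
          have h2 := Nat.mul_le_mul_right (Fintype.card V) this
          have h3 := (e v).2
          simp only [Nat.add_mul, one_mul] at h2 ⊢
          omega
        · have : (R - h v) * Fintype.card V < (R - n + 1) * Fintype.card V := by
            simp only at hv
            omega
          have := Nat.lt_of_mul_lt_mul_right this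
          have := hR v
          omega
      · exact ⟨0, fun v => by have := hR v; simp; omega⟩
  let S : ℕ → Finset V := fun m => {v | g v < m}
  let q : V → ℝ := fun v => f (S (g v + 1)) - f (S (g v))
  have hS0 : S 0 = ∅ := by simp [S]
  have hstep : ∀ m, S (m + 1) = S m ∨ ∃ v, g v = m ∧ v ∉ S m ∧ S (m + 1) = insert v (S m) := by
    intro m
    by_cases hm : ∃ v, g v = m
    · obtain ⟨v, rfl⟩ := hm
      refine Or.inr ⟨v, rfl, by simp [S], ?_⟩
      ext w
      simp only [S, Finset.mem_filter, Finset.mem_univ, true_and, Finset.mem_insert,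
        Nat.lt_succ_iff_lt_or_eq, hg.eq_iff]
      tauto
    · left
      ext w
      have : g w ≠ m := fun h => hm ⟨w, h⟩
      simp [S]; omega
  have hsum : ∀ m, ∑ v ∈ S m, q v = f (S m) := by
    intro m
    induction m with
    | zero => simp [hS0, f0]
    | succ m ih =>
      rcases hstep m with h1 | ⟨v, rfl, hv, h1⟩
      · rw [h1, ih]
      · rw [h1, Finset.sum_insert hv, ih, ← h1]
        simp [q]
  have hle : ∀ (I : Finset V) m, ∑ v ∈ I ∩ S m, q v ≤ f (I ∩ S m) := by
    intro I m
    induction m with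
    | zero => simp [hS0, f0]
    | succ m ih =>
      rcases hstep m with h1 | ⟨v, rfl, hv, h1⟩
      · rw [h1]; exact ih
      · by_cases hvI : v ∈ I
        · have h2 : I ∩ S (g v + 1) = insert v (I ∩ S (g v)) := by
            rw [h1, Finset.inter_insert_of_mem hvI]
          -- The increment of `f` at `v` over the whole segment is at most its increment over the
          -- part in `I`.
          have h3 := hf (I ∩ S (g v + 1)) (S (g v))
          have h4 : I ∩ S (g v + 1) ∪ S (g v) = S (g v + 1) := by
            rw [h2, h1]; ext w; simp; tauto
          have h5 : I ∩ S (g v + 1) ∩ S (g v) = I ∩ S (g v) := by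
            rw [h1]; ext w; simp; tauto
          rw [h4, h5] at h3
          rw [h2, Finset.sum_insert (by simp [hv]), ← h2]
          have : q v = f (S (g v + 1)) - f (S (g v)) := rfl
          linarith
        · rw [h1, Finset.inter_insert_of_notMem hvI]; exact ih
  obtain ⟨M, hM⟩ := hgh 0
  have hSM : S M = Finset.univ := by
    ext v; simpa [S] using (hM v).1 (Nat.zero_le _)
  refine ⟨q, ⟨fun I => ?_, ?_⟩, fun n => ?_⟩
  · simpa [hSM] using hle I M
  · simpa [hSM] using hsum M
  · obtain ⟨m, hm⟩ := hgh n
    have : ({v | n ≤ h v} : Finset V) = S m := by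
      ext v; simp [S, hm]
    rw [this, hsum]

/-- Abel summation along the levels of `h`. -/
lemma sum_level_mul (h : V → ℕ) (N : ℕ) (hN : ∀ v, h v ≤ N) (ω : ℕ → ℝ) (d : V → ℝ) :
    ∑ v, ω (h v) * d v = ω 0 * ∑ v, d v +
      ∑ n ∈ Finset.range N, (ω (n + 1) - ω n) * ∑ v with n + 1 ≤ h v, d v := by
  have h1 : ∀ v, ω (h v) =
      ω 0 + ∑ n ∈ Finset.range N, if n + 1 ≤ h v then ω (n + 1) - ω n else 0 := by
    intro v
    rw [← Finset.sum_filter]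
    have : ({n ∈ Finset.range N | n + 1 ≤ h v} : Finset ℕ) = Finset.range (h v) := by
      ext n; have := hN v; simp; omega
    rw [this, Finset.sum_range_sub]; ring
  simp_rw [Finset.mul_sum, Finset.sum_filter]
  rw [Finset.sum_comm, ← Finset.sum_add_distrib]
  refine Finset.sum_congr rfl fun v _ => ?_
  rw [h1 v, add_mul, Finset.sum_mul]
  simp [ite_mul]

/-- The maximizers of a linear functional over a base polytope form the tight face of the level
function of its coefficients. -/
theorem tightFace_eq_maximizers [DecidableEq V] {f : Finset V → ℝ} (f0 : f ∅ = 0)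
    (hf : ∀ I J, f (I ∪ J) + f (I ∩ J) ≤ f I + f J) {h : V → ℕ} {N : ℕ} (hN : ∀ v, h v ≤ N)
    {ω : ℕ → ℝ} (hω : ∀ n < N, ω n < ω (n + 1)) :
    tightFace f h = {q | q ∈ basePolytope f ∧
      ∀ p ∈ basePolytope f, ∑ v, ω (h v) * p v ≤ ∑ v, ω (h v) * q v} := by
  have hpos : ∀ n ∈ Finset.range N, 0 < ω (n + 1) - ω n := fun n hn =>
    sub_pos.2 (hω n (Finset.mem_range.1 hn))
  ext q
  constructor
  · rintro ⟨hq, ht⟩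
    refine ⟨hq, fun p hp => ?_⟩
    rw [sum_level_mul h N hN, sum_level_mul h N hN ω q, hp.2, hq.2]
    refine add_le_add_right (Finset.sum_le_sum fun n hn =>
      mul_le_mul_of_nonneg_left ?_ (hpos n hn).le) _
    rw [ht]; exact hp.1 _
  · rintro ⟨hq, hmax⟩
    -- Compared with a tight point `p`, each Abel term of `q` is at most that of `p`, while the sum
    -- is at least as large; hence all terms agree.
    obtain ⟨p, hp, ht⟩ := tightFace_nonempty f0 hf h
    have h1 := hmax p hp
    rw [sum_level_mul h N hN, sum_level_mul h N hN ω q, hp.2, hq.2, add_le_add_iff_left] at h1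
    have h2 : ∀ n ∈ Finset.range N, (ω (n + 1) - ω n) * ∑ v with n + 1 ≤ h v, q v ≤
        (ω (n + 1) - ω n) * ∑ v with n + 1 ≤ h v, p v := by
      intro n hn
      refine mul_le_mul_of_nonneg_left ?_ (hpos n hn).le
      rw [ht]; exact hq.1 _
    have h3 := (Finset.sum_eq_sum_iff_of_le h2).1 (le_antisymm (Finset.sum_le_sum h2) h1)
    refine ⟨hq, fun n => ?_⟩
    rcases n with _ | n
    · simpa using hq.2
    · by_cases hn : n < N
      · have := mul_left_cancel₀ (hpos n (by simpa using hn)).ne' (h3 n (by simpa using hn))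
        rw [this, ht]
      · have : ({v | n + 1 ≤ h v} : Finset V) = ∅ := by
          ext v; have := hN v; simp; omega
        rw [this, f0]; simp

/-- A nonempty upper level set of `h'` is an upper level set of `h`, with threshold the least value
of `h` on it. -/
theorem tightFace_subset_of_monotone {f : Finset V → ℝ} (f0 : f ∅ = 0) {h h' : V → ℕ}
    (hh : ∀ v w, h v ≤ h w → h' v ≤ h' w) :
    tightFace f h ⊆ tightFace f h' := by
  rintro q ⟨hq, ht⟩
  refine ⟨hq, fun n => ?_⟩
  by_cases hex : ∃ v, n ≤ h' v
  · have hne : ({v | n ≤ h' v} : Finset V).Nonempty := by simpa [Finset.Nonempty] using hex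
    obtain ⟨v, hv, hmin⟩ := Finset.exists_min_image _ h hne
    simp only [Finset.mem_filter, Finset.mem_univ, true_and] at hv hmin
    have : ({v | n ≤ h' v} : Finset V) = ({w | h v ≤ h w} : Finset V) := by
      ext w
      simpa using ⟨hmin w, fun hw => hv.trans (hh v w hw)⟩
    rw [this, ht]
  · have : ({v | n ≤ h' v} : Finset V) = ∅ := by
      push Not at hex
      ext v; simpa using hex v
    rw [this, f0]; simp

end Polymatroid

/-! ### The rank function of a residue space. -/

lemma Submodule.finrank_map_add_finrank_inf_ker {k M N : Type*} [Field k] [AddCommGroup M]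
    [Module k M] [FiniteDimensional k M] [AddCommGroup N] [Module k N]
    (W : Submodule k M) (f : M →ₗ[k] N) :
    Module.finrank k (W.map f) + Module.finrank k (W ⊓ LinearMap.ker f : Submodule k M) =
      Module.finrank k W := by
  rw [← LinearMap.finrank_range_add_finrank_ker (f.domRestrict W), LinearMap.range_domRestrict]
  congr 1
  rw [LinearMap.ker_domRestrict, ← Submodule.map_comap_subtype,
    ← Submodule.finrank_map_subtype_eq]

namespace ArrowGraph

open scoped Classical

variable {V A k : Type*} [Field k] (G : ArrowGraph V A)

lemma head_bar (a : A) : G.head (G.bar a) = G.tail a := by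
  rw [head, G.bar_bar]

lemma bar_involutive : Function.Involutive G.bar := G.bar_bar

lemma mem_ker_proj {I : Finset V} {ψ : A → k} :
    ψ ∈ LinearMap.ker (G.proj k I) ↔ ∀ a, G.tail a ∈ I → ψ a = 0 := by
  simp [proj, LinearMap.mem_ker, funext_iff, LinearMap.funLeft_apply]

lemma ker_proj_union (I J : Finset V) :
    LinearMap.ker (G.proj k (I ∪ J)) = LinearMap.ker (G.proj k I) ⊓ LinearMap.ker (G.proj k J) := by
  ext ψ
  simp only [Submodule.mem_inf, mem_ker_proj, Finset.mem_union]
  grind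

lemma ker_proj_anti {I J : Finset V} (h : I ⊆ J) :
    LinearMap.ker (G.proj k J) ≤ LinearMap.ker (G.proj k I) := by
  intro ψ hψ
  rw [mem_ker_proj] at hψ ⊢
  exact fun a ha => hψ a (h ha)

variable [Fintype A]

/-- Ranks are traded for dimensions of kernels, since kernels turn unions of vertex sets into
intersections of subspaces. -/
lemma gam_add_finrank (π : OrderedPartition V) (I : Finset V) :
    G.gam k π I + Module.finrank k (G.residueSpace k π ⊓ LinearMap.ker (G.proj k I) :
      Submodule k (A → k)) = Module.finrank k (G.residueSpace k π) :=
  Submodule.finrank_map_add_finrank_inf_ker _ _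

lemma gam_empty (π : OrderedPartition V) : G.gam k π ∅ = 0 := by
  have h := G.gam_add_finrank (k := k) π ∅
  have : LinearMap.ker (G.proj k ∅) = ⊤ := by
    ext ψ; simp only [mem_ker_proj]; simp
  rw [this, inf_top_eq] at h
  omega

lemma gam_submodular (π : OrderedPartition V) (I J : Finset V) :
    G.gam k π (I ∪ J) + G.gam k π (I ∩ J) ≤ G.gam k π I + G.gam k π J := by
  set W := G.residueSpace k π with hW
  have hgam := G.gam_add_finrank (k := k) π
  rw [← hW] at hgam
  have h1 := Submodule.finrank_sup_add_finrank_inf_eq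
    (W ⊓ LinearMap.ker (G.proj k I)) (W ⊓ LinearMap.ker (G.proj k J))
  have h2 : Module.finrank k ↥(W ⊓ LinearMap.ker (G.proj k I) ⊔ W ⊓ LinearMap.ker (G.proj k J)) ≤
      Module.finrank k ↥(W ⊓ LinearMap.ker (G.proj k (I ∩ J))) :=
    Submodule.finrank_mono (sup_le
      (inf_le_inf_left _ (G.ker_proj_anti Finset.inter_subset_left))
      (inf_le_inf_left _ (G.ker_proj_anti Finset.inter_subset_right)))
  rw [← inf_inf_distrib_left, ← ker_proj_union] at h1
  have := hgam I
  have := hgam J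
  have := hgam (I ∪ J)
  have := hgam (I ∩ J)
  omega

lemma mem_residueSpace {π : OrderedPartition V} {ψ : A → k} :
    ψ ∈ G.residueSpace k π ↔
      (∀ a, G.IsDownward π a → ψ a = 0) ∧
      (∀ v : V, ∑ a with G.tail a = v, ψ a = 0) ∧
      (∀ a, G.IsHorizontal π a → ψ a + ψ (G.bar a) = 0) ∧
      (∀ (n : Fin π.r) (Ξ : (G.below π n).ConnectedComponent),
        ∑ a with a ∈ G.arrowsInto π n Ξ, ψ a = 0) := Iff.rfl

lemma mem_residueSpace_trivial [Nonempty V] {ψ : A → k} :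
    ψ ∈ G.residueSpace k (OrderedPartition.trivial V) ↔
      (∀ v : V, ∑ a with G.tail a = v, ψ a = 0) ∧ ∀ a, ψ a + ψ (G.bar a) = 0 := by
  rw [mem_residueSpace]
  constructor
  · rintro ⟨-, h2, h3, -⟩
    exact ⟨h2, fun a => h3 a rfl⟩
  · rintro ⟨h2, h3⟩
    refine ⟨fun a ha => absurd ha (lt_irrefl _), h2, fun a _ => h3 a, fun n Ξ => ?_⟩
    induction Ξ using SimpleGraph.ConnectedComponent.ind with
    | h v =>
      have h0 : (0 : ℕ) < n := v.2
      have h1 : (n : ℕ) < 1 := n.2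
      omega

/-- The part of `ψ` carried by the arrows whose tail has a level satisfying `p`. -/
noncomputable def restrictLevel (π : OrderedPartition V) (p : ℕ → Prop) (ψ : A → k) : A → k :=
  fun a => if p (π.level (G.tail a)) then ψ a else 0

lemma restrictLevel_mem {π : OrderedPartition V} (p : ℕ → Prop) {ψ : A → k}
    (hψ : ψ ∈ G.residueSpace k π) : G.restrictLevel π p ψ ∈ G.residueSpace k π := by
  obtain ⟨h1, h2, h3, h4⟩ := hψ
  refine ⟨fun a ha => ?_, fun v => ?_, fun a ha => ?_, fun n Ξ => ?_⟩
  · simp [restrictLevel, h1 a ha]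
  · rw [Finset.sum_congr rfl (g := fun a => if p (π.level v) then ψ a else 0)]
    · split_ifs
      · exact h2 v
      · simp
    · intro a ha
      simp only [Finset.mem_filter, Finset.mem_univ, true_and] at ha
      simp only [restrictLevel, ha]
  · have : π.level (G.tail (G.bar a)) = π.level (G.tail a) := ha.symm
    simp only [restrictLevel, this]
    split_ifs
    · exact h3 a ha
    · simp
  · rw [Finset.sum_congr rfl (g := fun a => if p n then ψ a else 0)]
    · split_ifs
      · exact h4 n Ξ
      · simp
    · intro a ha
      simp only [Finset.mem_filter, Finset.mem_univ, true_and] at ha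
      simp only [restrictLevel, ha.2.1]

/-- Splitting an element by the level of the tail shows that the two kernels together span the
residue space, so the dimension formula is an equality. -/
lemma gam_eq_add_of_level (π : OrderedPartition V) (p : ℕ → Prop) (I : Finset V) :
    G.gam k π I = G.gam k π {v ∈ I | p (π.level v)} + G.gam k π {v ∈ I | ¬ p (π.level v)} := by
  set W := G.residueSpace k π with hW
  have hgam := G.gam_add_finrank (k := k) π
  rw [← hW] at hgam
  have h1 := Submodule.finrank_sup_add_finrank_inf_eq
    (W ⊓ LinearMap.ker (G.proj k {v ∈ I | p (π.level v)}))
    (W ⊓ LinearMap.ker (G.proj k {v ∈ I | ¬ p (π.level v)}))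
  have h2 : W ⊓ LinearMap.ker (G.proj k {v ∈ I | p (π.level v)}) ⊔
      W ⊓ LinearMap.ker (G.proj k {v ∈ I | ¬ p (π.level v)}) = W := by
    refine le_antisymm (sup_le inf_le_left inf_le_left) fun ψ hψ => ?_
    rw [Submodule.mem_sup]
    refine ⟨G.restrictLevel π (fun n => ¬ p n) ψ, ⟨G.restrictLevel_mem _ hψ, ?_⟩,
      G.restrictLevel π p ψ, ⟨G.restrictLevel_mem _ hψ, ?_⟩, ?_⟩
    · rw [SetLike.mem_coe, mem_ker_proj]
      intro a ha
      have := (Finset.mem_filter.1 ha).2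
      simp [restrictLevel, this]
    · rw [SetLike.mem_coe, mem_ker_proj]
      intro a ha
      have := (Finset.mem_filter.1 ha).2
      simp [restrictLevel, this]
    · ext a
      by_cases h : p (π.level (G.tail a)) <;> simp [restrictLevel, h]
  rw [h2, ← inf_inf_distrib_left, ← ker_proj_union, Finset.filter_union_filter_not_eq] at h1
  have := hgam I
  have := hgam {v ∈ I | p (π.level v)}
  have := hgam {v ∈ I | ¬ p (π.level v)}
  omega

/-! ### Prescribing the divergence of a flow inside a vertex set. -/

section Flow

/-- The divergences of the antisymmetric functions carried by the arrows inside `S`. -/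
noncomputable def divergences (k : Type*) [Field k] (S : Set V) : Submodule k (V → k) where
  carrier := {b | ∃ θ : A → k, (∀ a, θ a + θ (G.bar a) = 0) ∧
    (∀ a, θ a ≠ 0 → G.tail a ∈ S ∧ G.head a ∈ S) ∧ ∀ v, ∑ a with G.tail a = v, θ a = b v}
  zero_mem' := ⟨0, by simp⟩
  add_mem' := by
    rintro b c ⟨θ, h1, h2, h3⟩ ⟨η, g1, g2, g3⟩
    refine ⟨θ + η, fun a => ?_, fun a ha => ?_, fun v => ?_⟩
    · simp only [Pi.add_apply]
      linear_combination h1 a + g1 a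
    · by_cases h : θ a = 0
      · exact g2 a (by simpa [h] using ha)
      · exact h2 a h
    · simp [Finset.sum_add_distrib, h3, g3]
  smul_mem' := by
    rintro c b ⟨θ, h1, h2, h3⟩
    refine ⟨c • θ, fun a => ?_, fun a ha => ?_, fun v => ?_⟩
    · simp only [Pi.smul_apply, smul_eq_mul]
      linear_combination c * h1 a
    · exact h2 a (by simp at ha; exact ha.2)
    · simp [← Finset.mul_sum, h3]

variable {S : Set V}

lemma single_tail_sub_single_head_mem {a : A} (ht : G.tail a ∈ S) (hh : G.head a ∈ S) :
    (Pi.single (G.tail a) 1 - Pi.single (G.head a) 1 : V → k) ∈ G.divergences k S := by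
  refine ⟨Pi.single a 1 - Pi.single (G.bar a) 1, fun b => ?_, fun b hb => ?_, fun v => ?_⟩
  · have h1 : G.bar b = G.bar a ↔ b = a := G.bar_involutive.injective.eq_iff
    have h2 : G.bar b = a ↔ b = G.bar a := G.bar_involutive.eq_iff
    simp only [Pi.sub_apply, Pi.single_apply, h1, h2]
    ring
  · have : b = a ∨ b = G.bar a := by
      by_contra hcon
      push Not at hcon
      simp [hcon.1, hcon.2] at hb
    rcases this with rfl | rfl
    · exact ⟨ht, hh⟩
    · exact ⟨hh, by rwa [head_bar]⟩
  · simp only [Pi.sub_apply, Finset.sum_sub_distrib, Pi.single_apply, Finset.sum_ite_eq',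
      Finset.mem_filter, Finset.mem_univ, true_and]
    simp only [head, eq_comm]
    congr

/-- Unit flows along the edges of a walk have telescoping divergences. -/
lemma single_sub_single_mem_of_reachable {u v : S}
    (h : (G.toSimpleGraph.induce S).Reachable u v) :
    (Pi.single (u : V) 1 - Pi.single (v : V) 1 : V → k) ∈ G.divergences k S := by
  rw [SimpleGraph.reachable_iff_reflTransGen] at h
  induction h with
  | refl => simp
  | @tail v w _ hvw ih =>
    have hadj : (Pi.single (v : V) 1 - Pi.single (w : V) 1 : V → k) ∈ G.divergences k S := by
      have hvw' : G.toSimpleGraph.Adj v w := hvw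
      rw [toSimpleGraph, SimpleGraph.fromRel_adj] at hvw'
      obtain ⟨a, h1, h2⟩ | ⟨a, h1, h2⟩ := hvw'.2
      · have := G.single_tail_sub_single_head_mem (k := k) (S := S) (a := a)
          (by rw [h1]; exact v.2) (by rw [h2]; exact w.2)
        rwa [h1, h2] at this
      · have := G.single_tail_sub_single_head_mem (k := k) (S := S) (a := a)
          (by rw [h1]; exact w.2) (by rw [h2]; exact v.2)
        rw [h1, h2] at this
        simpa using neg_mem this
    simpa using add_mem ih hadj

/-- A function on `S` is a divergence if its sum over each component of `S` vanishes. -/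
lemma mem_divergences [Fintype V] {b : V → k} (hb : ∀ v, v ∉ S → b v = 0)
    (hsum : ∀ Ξ : (G.toSimpleGraph.induce S).ConnectedComponent,
      ∑ v with v ∈ Subtype.val '' Ξ.supp, b v = 0) :
    b ∈ G.divergences k S := by
  -- Send all of `b` to one representative per component; what accumulates there is the sum over the
  -- component, which is zero.
  let rep : S → S := fun v => ((G.toSimpleGraph.induce S).connectedComponentMk v).out
  have hrep : ∀ v : S, (G.toSimpleGraph.induce S).Reachable v (rep v) := fun v =>
    SimpleGraph.ConnectedComponent.exact (Quot.out_eq _).symm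
  have key : b = ∑ v : S, b v • (Pi.single (v : V) 1 - Pi.single (rep v : V) 1 : V → k) := by
    simp only [smul_sub, Finset.sum_sub_distrib]
    have h1 : ∑ v : S, b v • (Pi.single (v : V) 1 : V → k) = b := by
      ext w
      simp only [Finset.sum_apply, Pi.smul_apply, smul_eq_mul, Pi.single_apply, mul_ite, mul_one,
        mul_zero]
      by_cases hw : w ∈ S
      · rw [Finset.sum_eq_single (⟨w, hw⟩ : S)]
        · simp
        · intro v _ hv
          rw [if_neg]
          rintro rfl
          exact hv rfl
        · simp
      · rw [hb w hw]
        refine Finset.sum_eq_zero fun v _ => if_neg ?_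
        rintro rfl
        exact hw v.2
    have h2 : ∑ v : S, b v • (Pi.single (rep v : V) 1 : V → k) = 0 := by
      rw [← Finset.sum_fiberwise Finset.univ (G.toSimpleGraph.induce S).connectedComponentMk]
      refine Finset.sum_eq_zero fun Ξ _ => ?_
      rw [Finset.sum_congr rfl (g := fun v : S => b v • (Pi.single (Ξ.out : V) 1 : V → k))]
      · rw [← Finset.sum_smul]
        convert zero_smul k _
        rw [← hsum Ξ]
        refine Finset.sum_bij (fun v _ => (v : V)) ?_ ?_ ?_ ?_
        · intro v hv
          simpa [SimpleGraph.ConnectedComponent.mem_supp_iff] using hv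
        · intro v _ w _ h
          exact Subtype.ext h
        · intro v hv
          simp only [Finset.mem_filter, Finset.mem_univ, true_and] at hv
          obtain ⟨w, hw, rfl⟩ := hv
          exact ⟨w, by simpa [SimpleGraph.ConnectedComponent.mem_supp_iff] using hw, rfl⟩
        · intro v _; rfl
      · intro v hv
        simp only [Finset.mem_filter, Finset.mem_univ, true_and] at hv
        simp only [rep, hv]
    rw [h1, h2, sub_zero]
  rw [key]
  exact sum_mem fun v _ => Submodule.smul_mem _ _ (G.single_sub_single_mem_of_reachable (hrep v))

end Flow

end ArrowGraph

/-! ### Level parts of the residue space as level parts of flows. -/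

namespace ArrowGraph

open scoped Classical

variable {V A k : Type*} [Field k] (G : ArrowGraph V A)

lemma tail_mem_component {π : OrderedPartition V} {n : Fin π.r}
    (Ξ : (G.below π n).ConnectedComponent) {a : A} (hh : G.head a ∈ Subtype.val '' Ξ.supp)
    (ht : π.level (G.tail a) < n) : G.tail a ∈ Subtype.val '' Ξ.supp := by
  obtain ⟨w, hw, hwa⟩ := hh
  by_cases heq : G.tail a = G.head a
  · rw [heq]; exact ⟨w, hw, hwa⟩
  · refine ⟨⟨G.tail a, ht⟩, ?_, rfl⟩
    rw [SimpleGraph.ConnectedComponent.mem_supp_iff] at hw ⊢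
    rw [← hw, SimpleGraph.ConnectedComponent.eq]
    refine SimpleGraph.Adj.reachable ?_
    change G.toSimpleGraph.Adj (G.tail a) w
    rw [toSimpleGraph, SimpleGraph.fromRel_adj, hwa]
    exact ⟨heq, Or.inl ⟨a, rfl, rfl⟩⟩

lemma level_lt_of_mem_component {π : OrderedPartition V} {n : Fin π.r}
    {Ξ : (G.below π n).ConnectedComponent} {v : V} (hv : v ∈ Subtype.val '' Ξ.supp) :
    π.level v < n := by
  obtain ⟨w, -, rfl⟩ := hv
  exact w.2

variable [Fintype A]

lemma sum_comp_bar (f : A → k) : ∑ a, f (G.bar a) = ∑ a, f a :=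
  Equiv.sum_comp G.bar_involutive.toPerm f

variable [Fintype V]

lemma sum_sum_tail (X : Set V) (ψ : A → k) :
    ∑ v with v ∈ X, ∑ a with G.tail a = v, ψ a = ∑ a, if G.tail a ∈ X then ψ a else 0 := by
  simp only [Finset.sum_filter]
  have : ∀ v, (if v ∈ X then ∑ a, (if G.tail a = v then ψ a else 0) else 0) =
      ∑ a, if G.tail a = v then (if G.tail a ∈ X then ψ a else 0) else 0 := by
    intro v
    split_ifs with hv
    · exact Finset.sum_congr rfl fun a _ => by split_ifs <;> simp_all
    · exact (Finset.sum_eq_zero fun a _ => by split_ifs <;> simp_all).symm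
  simp only [this]
  rw [Finset.sum_comm]
  simp

variable [Nonempty V]

/-- A flow that vanishes above level `n` has residues zero through each component below `n`. -/
lemma sum_arrowsInto_eq_zero {π : OrderedPartition V} (n : Fin π.r) {ψ : A → k}
    (hψ : ψ ∈ G.residueSpace k (OrderedPartition.trivial V))
    (h0 : ∀ a, n < π.level (G.tail a) → ψ a = 0) (Ξ : (G.below π n).ConnectedComponent) :
    ∑ a with a ∈ G.arrowsInto π n Ξ, ψ a = 0 := by
  obtain ⟨hdiv, hanti⟩ := G.mem_residueSpace_trivial.1 hψ
  set X : Set V := Subtype.val '' Ξ.supp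
  have h1 : ∑ a, (if G.tail a ∈ X then ψ a else 0) = 0 := by
    rw [← G.sum_sum_tail]
    exact Finset.sum_eq_zero fun v _ => hdiv v
  have htb : ∀ a, G.tail (G.bar a) = G.head a := fun _ => rfl
  -- Arrows inside `X` cancel in pairs. That `bar` has no fixed point matters in characteristic 2.
  have h2 : ∑ a, (if G.tail a ∈ X ∧ G.head a ∈ X then ψ a else 0) = 0 := by
    refine Finset.sum_involution (fun a _ => G.bar a) (fun a _ => ?_) (fun a _ _ => G.bar_ne a)
      (fun a _ => Finset.mem_univ _) (fun a _ => G.bar_bar a)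
    simp only [head_bar, htb, and_comm (b := G.tail a ∈ X)]
    split_ifs
    · exact hanti a
    · simp
  have h3 : ∑ a, (if G.tail a ∈ X ∧ G.head a ∉ X then ψ a else 0) = 0 := by
    refine (add_zero _).symm.trans ((congrArg _ h2.symm).trans (Eq.trans ?_ h1))
    rw [← Finset.sum_add_distrib]
    refine Finset.sum_congr rfl fun a _ => ?_
    by_cases ht : G.tail a ∈ X <;> by_cases hh : G.head a ∈ X <;> simp [ht, hh]
  rw [← G.sum_comp_bar] at h3
  refine neg_eq_zero.1 (Eq.trans ?_ h3)
  rw [Finset.sum_filter, ← Finset.sum_neg_distrib]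
  refine Finset.sum_congr rfl fun a _ => ?_
  simp only [head_bar, htb]
  rw [← neg_eq_of_add_eq_zero_right (hanti a)]
  by_cases hh : G.head a ∈ X
  · have hlt : π.level (G.head a) < n := G.level_lt_of_mem_component hh
    -- A tail below `n` lies in `X` itself and above `n` the flow vanishes, so only tails of level
    -- `n` contribute.
    rcases lt_trichotomy (π.level (G.tail a)) n with ht | ht | ht
    · have h4 : G.tail a ∈ X := G.tail_mem_component Ξ hh ht
      have h5 : a ∉ G.arrowsInto π n Ξ := fun h => ht.ne h.2.1
      simp [h4, h5]
    · have h4 : G.tail a ∉ X := fun h => (G.level_lt_of_mem_component h).ne ht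
      have h5 : a ∈ G.arrowsInto π n Ξ := ⟨by rw [IsUpward, ht]; exact hlt, ht, hh⟩
      simp [h4, h5, hh]
    · simp [h0 a ht]
  · have h5 : a ∉ G.arrowsInto π n Ξ := fun h => hh h.2.2
    simp [hh, h5]

lemma restrictLevel_mem_of_trivial {π : OrderedPartition V} (n : Fin π.r) {ψ : A → k}
    (hψ : ψ ∈ G.residueSpace k (OrderedPartition.trivial V))
    (h0 : ∀ a, n < π.level (G.tail a) → ψ a = 0) :
    G.restrictLevel π (· = (n : ℕ)) ψ ∈ G.residueSpace k π := by
  obtain ⟨hdiv, hanti⟩ := G.mem_residueSpace_trivial.1 hψ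
  have hval : ∀ m : Fin π.r, (m : ℕ) = n ↔ m = n := fun m => Fin.val_inj
  refine ⟨fun a ha => ?_, fun v => ?_, fun a ha => ?_, fun m Ξ => ?_⟩
  · simp only [restrictLevel, hval]
    split_ifs with h
    · have hb : ψ (G.bar a) = 0 := h0 (G.bar a) (h ▸ ha)
      simpa [hb] using hanti a
    · rfl
  · rw [Finset.sum_congr rfl (g := fun a => if π.level v = n then ψ a else 0)]
    · split_ifs
      · exact hdiv v
      · simp
    · intro a ha
      simp only [Finset.mem_filter, Finset.mem_univ, true_and] at ha
      simp only [restrictLevel, ha, hval]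
  · have : π.level (G.tail (G.bar a)) = π.level (G.tail a) := ha.symm
    simp only [restrictLevel, this]
    split_ifs
    · exact hanti a
    · simp
  · rw [Finset.sum_congr rfl (g := fun a => if m = n then ψ a else 0)]
    · split_ifs with h
      · subst h
        exact G.sum_arrowsInto_eq_zero m hψ h0 Ξ
      · simp
    · intro a ha
      simp only [Finset.mem_filter, Finset.mem_univ, true_and] at ha
      simp only [restrictLevel, ha.2.1, hval]

/-- The level `n` part of an element of the residue space extends to a flow on the whole graph that
vanishes above level `n`. -/
lemma exists_flow_extending {π : OrderedPartition V} (n : Fin π.r) {φ : A → k}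
    (hφ : φ ∈ G.residueSpace k π) :
    ∃ ψ ∈ G.residueSpace k (OrderedPartition.trivial V),
      (∀ a, n < π.level (G.tail a) → ψ a = 0) ∧ ∀ a, π.level (G.tail a) = n → ψ a = φ a := by
  obtain ⟨h1, h2, h3, h4⟩ := hφ
  have htb : ∀ a, G.tail (G.bar a) = G.head a := fun _ => rfl
  -- Antisymmetric extension of the level `n` part of `φ`; on arrows within level `n` it is
  -- consistent by (R3).
  let η : A → k := fun a =>
    if π.level (G.tail a) = n then φ a else if π.level (G.head a) = n then -φ (G.bar a) else 0
  have hηanti : ∀ a, η a + η (G.bar a) = 0 := by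
    intro a
    simp only [η, htb, head_bar, G.bar_bar]
    split_ifs with ht hh hh
    · exact h3 a (ht.trans hh.symm)
    · simp
    · simp
    · simp
  have hηabove : ∀ a, n < π.level (G.tail a) → η a = 0 := by
    intro a ha
    simp only [η, ha.ne', if_false]
    split_ifs with hh
    · rw [h1 (G.bar a), neg_zero]
      rw [IsDownward, htb, head_bar, hh]
      exact ha
    · rfl
  -- The divergence still to be cancelled. It lives below `n` by (R2), and its sum over each
  -- component there vanishes by (R4), so a flow `θ` strictly below `n` corrects it without touching
  -- level `n` or above.
  let b : V → k := fun v => -∑ a with G.tail a = v, η a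
  have hb : b ∈ G.divergences k {v : V | π.level v < n} := by
    refine G.mem_divergences (fun v hv => ?_) fun Ξ => ?_
    · have hv' : n ≤ π.level v := not_lt.1 hv
      rcases hv'.eq_or_lt with hv' | hv'
      · rw [← neg_zero, ← h2 v]
        refine congrArg Neg.neg (Finset.sum_congr rfl fun a ha => ?_)
        simp only [Finset.mem_filter, Finset.mem_univ, true_and] at ha
        simp only [η, ha, hv'.symm, if_true]
      · refine neg_eq_zero.2 (Finset.sum_eq_zero fun a ha => hηabove a ?_)
        simp only [Finset.mem_filter, Finset.mem_univ, true_and] at ha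
        rwa [ha]
    · simp only [b]
      refine Eq.trans ?_ (h4 n Ξ)
      rw [Finset.sum_neg_distrib, G.sum_sum_tail, ← G.sum_comp_bar, ← Finset.sum_neg_distrib,
        Finset.sum_filter]
      refine Finset.sum_congr rfl fun a _ => ?_
      simp only [htb]
      by_cases hh : G.head a ∈ Subtype.val '' Ξ.supp
      · have hlt : π.level (G.head a) < n := G.level_lt_of_mem_component hh
        rw [if_pos hh]
        simp only [η, htb, hlt.ne, if_false, head_bar, G.bar_bar]
        by_cases ht : π.level (G.tail a) = n
        · have h5 : a ∈ G.arrowsInto π n Ξ := ⟨by rw [IsUpward, ht]; exact hlt, ht, hh⟩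
          simp [ht, h5]
        · have h5 : a ∉ G.arrowsInto π n Ξ := fun h => ht h.2.1
          simp [ht, h5]
      · have h5 : a ∉ G.arrowsInto π n Ξ := fun h => hh h.2.2
        rw [if_neg hh, if_neg h5, neg_zero]
  obtain ⟨θ, hθanti, hθsupp, hθdiv⟩ := hb
  have hθ : ∀ a, n ≤ π.level (G.tail a) → θ a = 0 := fun a ha => by
    by_contra hne
    exact absurd (hθsupp a hne).1 (not_lt.2 ha)
  refine ⟨η + θ, G.mem_residueSpace_trivial.2 ⟨fun v => ?_, fun a => ?_⟩, fun a ha => ?_,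
    fun a ha => ?_⟩
  · simp [Finset.sum_add_distrib, hθdiv, b]
  · simp only [Pi.add_apply]
    linear_combination hηanti a + hθanti a
  · simp [hηabove a ha, hθ a ha.le]
  · simp [hθ a ha.ge, η, ha]

lemma map_proj_residueSpace (π : OrderedPartition V) (n : Fin π.r) {I : Finset V}
    (hI : ∀ v ∈ I, π.level v = n) :
    (G.residueSpace k π).map (G.proj k I) =
      (G.residueSpace k (OrderedPartition.trivial V) ⊓
        LinearMap.ker (G.proj k (Finset.univ.filter fun v => n < π.level v))).map
          (G.proj k I) := by
  ext x
  simp only [Submodule.mem_map, Submodule.mem_inf, mem_ker_proj, Finset.mem_filter,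
    Finset.mem_univ, true_and]
  constructor
  · rintro ⟨φ, hφ, rfl⟩
    obtain ⟨ψ, hψ, h0, hn⟩ := G.exists_flow_extending n hφ
    exact ⟨ψ, ⟨hψ, h0⟩, funext fun a => hn a (hI _ a.2)⟩
  · rintro ⟨ψ, ⟨hψ, h0⟩, rfl⟩
    refine ⟨_, G.restrictLevel_mem_of_trivial n hψ h0, funext fun a => ?_⟩
    simp [proj, LinearMap.funLeft_apply, restrictLevel, hI _ a.2]

/-- On one level, the rank function of the residue space is the contraction of that of the flow
space by the levels above. -/
lemma gam_level (π : OrderedPartition V) (n : ℕ) (I : Finset V)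
    (hI : ∀ v ∈ I, (π.level v : ℕ) = n) :
    G.gam k π I + G.gam k (OrderedPartition.trivial V)
        (Finset.univ.filter fun v => n + 1 ≤ (π.level v : ℕ)) =
      G.gam k (OrderedPartition.trivial V)
        ((Finset.univ.filter fun v => n + 1 ≤ (π.level v : ℕ)) ∪ I) := by
  -- For empty `I` the number `n` need not be a level of `π`.
  rcases I.eq_empty_or_nonempty with rfl | ⟨w, hw⟩
  · simp [gam_empty]
  obtain ⟨m, rfl⟩ : ∃ m : Fin π.r, (m : ℕ) = n := ⟨_, hI w hw⟩
  have h1 := G.map_proj_residueSpace (k := k) π m fun v hv => Fin.ext (hI v hv)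
  have hF : (Finset.univ.filter fun v => (m : ℕ) + 1 ≤ (π.level v : ℕ)) =
      Finset.univ.filter fun v => m < π.level v := rfl
  rw [hF]
  set F := Finset.univ.filter fun v => m < π.level v
  have h2 := Submodule.finrank_map_add_finrank_inf_ker
    (G.residueSpace k (OrderedPartition.trivial V) ⊓ LinearMap.ker (G.proj k F)) (G.proj k I)
  rw [← h1, inf_assoc, ← ker_proj_union] at h2
  have h3 := G.gam_add_finrank (k := k) (OrderedPartition.trivial V) F
  have h4 := G.gam_add_finrank (k := k) (OrderedPartition.trivial V) (F ∪ I)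
  change G.gam k π I + _ = _ at h2
  omega

theorem residuePolytope_eq_tightFace (π : OrderedPartition V) :
    G.residuePolytope k π = tightFace
      (fun I => (G.gam k (OrderedPartition.trivial V) I : ℝ)) (fun v => (π.level v : ℕ)) := by
  refine basePolytope_eq_tightFace (by simp [gam_empty])
    (fun I J => by exact_mod_cast G.gam_submodular _ I J) (fun p _ I => ?_)
    (fun n I hI => by exact_mod_cast G.gam_level π n I hI)
  have := G.gam_eq_add_of_level (k := k) π p I
  norm_cast
  convert this

end ArrowGraph

/-! ### Faces of the residue polytope. -/

/-- The same functional works: a maximizer over `Q` does at least as well as a point of `F`, hence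
maximizes over `P`. -/
lemma IsFace.of_subset {V : Type*} {P Q F : Set (V → ℝ)} (hF : IsFace P F) (hFQ : F ⊆ Q)
    (hQP : Q ⊆ P) : IsFace Q F := by
  refine ⟨hF.1, fun hne => ?_⟩
  obtain ⟨l, hl⟩ := hF.2 hne
  refine ⟨l, Set.ext fun x => ⟨fun hx => ?_, fun hx => ?_⟩⟩
  · have hx' := hx
    rw [hl] at hx'
    exact ⟨hFQ hx, fun y hy => hx'.2 y (hQP hy)⟩
  · obtain ⟨z, hz⟩ := hne
    have hz' := hz
    rw [hl] at hz' ⊢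
    exact ⟨hQP hx.1, fun y hy => (hz'.2 y hy).trans (hx.2 z (hFQ hz))⟩

namespace ArrowGraph

open scoped Classical

variable {V A k : Type*} [Field k] [Fintype V] [Nonempty V] [Fintype A] (G : ArrowGraph V A)

/-- The weights are left free: level numbers serve (1), the coefficients of a given functional serve
(2). -/
theorem residuePolytope_eq_maximizers (π : OrderedPartition V) {ω : Fin π.r → ℝ}
    (hω : StrictMono ω) :
    G.residuePolytope k π = {q | q ∈ G.residuePolytope k (OrderedPartition.trivial V) ∧
      ∀ p ∈ G.residuePolytope k (OrderedPartition.trivial V),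
        ∑ v, ω (π.level v) * p v ≤ ∑ v, ω (π.level v) * q v} := by
  have h := tightFace_eq_maximizers (f := fun I => (G.gam k (OrderedPartition.trivial V) I : ℝ))
    (by simp [gam_empty]) (fun I J => by exact_mod_cast G.gam_submodular _ I J)
    (h := fun v => (π.level v : ℕ)) (N := π.r - 1) (fun v => by have := (π.level v).2; omega)
    -- The top level is `π.r - 1`, so the default `0` is never used.
    (ω := fun n => if hn : n < π.r then ω ⟨n, hn⟩ else 0)
    (fun n hn => by
      rw [dif_pos (by omega), dif_pos (by omega)]
      exact hω (Fin.mk_lt_mk.2 (Nat.lt_succ_self n)))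
  rw [G.residuePolytope_eq_tightFace, h]
  simp [residuePolytope]

theorem isFace_residuePolytope (π : OrderedPartition V) :
    IsFace (G.residuePolytope k (OrderedPartition.trivial V)) (G.residuePolytope k π) := by
  refine ⟨?_, fun _ => ?_⟩
  · rw [G.residuePolytope_eq_tightFace]
    exact tightFace_nonempty (by simp [gam_empty])
      (fun I J => by exact_mod_cast G.gam_submodular _ I J) _
  · let l : (V → ℝ) →ₗ[ℝ] ℝ := ∑ v, ((π.level v : ℕ) : ℝ) • LinearMap.proj v
    refine ⟨LinearMap.toContinuousLinearMap l, ?_⟩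
    rw [G.residuePolytope_eq_maximizers π (ω := fun n => ((n : ℕ) : ℝ))
      fun m n h => Nat.cast_lt.2 (Fin.lt_def.1 h)]
    simp [l]

end ArrowGraph

/-- The ordered partition of `V` by the values of a real function. -/
noncomputable def OrderedPartition.ofFun {V : Type*} [Fintype V] (w : V → ℝ) :
    OrderedPartition V where
  r := (Finset.univ.image w).card
  level v := ((Finset.univ.image w).orderIsoOfFin rfl).symm
    ⟨w v, Finset.mem_image_of_mem w (Finset.mem_univ v)⟩
  surj n := by
    obtain ⟨v, -, hv⟩ := Finset.mem_image.1 ((Finset.univ.image w).orderIsoOfFin rfl n).2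
    exact ⟨v, (OrderIso.symm_apply_eq _).2 (Subtype.ext hv)⟩

theorem theorem1p2 {V A : Type*} [Fintype V] [Nonempty V] [Fintype A] (k : Type*) [Field k]
    (G : ArrowGraph V A) :
    (∀ π : OrderedPartition V,
      IsFace (G.residuePolytope k (OrderedPartition.trivial V)) (G.residuePolytope k π)) ∧
    (∀ F : Set (V → ℝ), IsFace (G.residuePolytope k (OrderedPartition.trivial V)) F →
      ∃ π : OrderedPartition V, F = G.residuePolytope k π) ∧
    (∀ π π' : OrderedPartition V, π'.IsCoarsening π →
      G.residuePolytope k π ⊆ G.residuePolytope k π' ∧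
        IsFace (G.residuePolytope k π') (G.residuePolytope k π)) := by
  classical
  refine ⟨G.isFace_residuePolytope, ?_, ?_⟩
  · rintro F ⟨hne, hF⟩
    obtain ⟨l, rfl⟩ := hF hne
    let w : V → ℝ := fun v => l (Pi.single v 1)
    refine ⟨OrderedPartition.ofFun w, ?_⟩
    rw [G.residuePolytope_eq_maximizers (OrderedPartition.ofFun w)
      -- With these weights, the weight of the level of `v` is `w v`.
      (ω := fun n => ((Finset.univ.image w).orderIsoOfFin rfl n : ℝ))
      fun m n h => ((Finset.univ.image w).orderIsoOfFin rfl).strictMono h]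
    have hl : ∀ q, l q = ∑ v, w v * q v := by
      intro q
      conv_lhs => rw [pi_eq_sum_univ' q, map_sum]
      refine Finset.sum_congr rfl fun v _ => ?_
      rw [map_smul, smul_eq_mul, mul_comm]
    simp [OrderedPartition.ofFun, hl]
  · rintro π π' ⟨c, hc, hcπ⟩
    have hsub : G.residuePolytope k π ⊆ G.residuePolytope k π' := by
      rw [G.residuePolytope_eq_tightFace, G.residuePolytope_eq_tightFace]
      refine tightFace_subset_of_monotone (by simp [ArrowGraph.gam_empty]) fun v w hvw => ?_
      rw [hcπ]
      exact hc (Fin.le_def.2 hvw)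
    exact ⟨hsub, (G.isFace_residuePolytope π).of_subset hsub
      (IsExposed.subset (G.isFace_residuePolytope π').2)⟩
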